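/- For a compact metric space $(X,d)$ and a continuous map $f:X\to X$, let $\mathrm{sep}(f,m,\varepsilon)$ be the maximal cardinality of a set $E\subset X$ such that $\max_{0\le k\le m-1}d(f^k(x),f^k(y))\ge\varepsilon$ for all distinct $x,y\in E$, and let $$h(f)=\lim_{\varepsilon\to0}\limsup_{m\to\infty}\frac{\log\mathrm{sep}(f,m,\varepsilon)}{m},\qquad h_{\mathrm{pol}}(f)=\lim_{\varepsilon\to0}\limsup_{m\to\infty}\frac{\log\mathrm{sep}(f,m,\varepsilon)}{\log m}$$ (values in $[0,\infty]$) be its topological and polynomial entropy. Let $2^X$ be the space of nonempty closed subsets of $X$ with the Hausdorff metric, $C(X)\subset 2^X$ the set of connected elements, and $C_n(X)\subset 2^X$ the set of elements with at most $n$ connected components. Let $2^f:2^X\to2^X$, $A\mapsto f(A)$, and let $C(f)$, $C_n(f)$ be its restrictions to $C(X)$, $C_n(X)$. **Theorem.** (1) There is a continuous map $f:[0,1]\to[0,1]$ with $h(f)>0$ such that for all $n\ge2$ $$h(C(f))<h(C_n(f))<h(C_{n+1}(f))<h(2^f).$$ (2) There is a homeomorphism $f:[0,1]\to[0,1]$ that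 has a wandering point (a point with a neighbourhood $U$ such that $f^k(U)\cap U=\emptyset$ for all $k\ge1$), such that $h_{\mathrm{pol}}(C_n(f))=2n$ for all $n\ge1$, and for all $n\ge2$ $$h_{\mathrm{pol}}(C(f))<h_{\mathrm{pol}}(C_n(f))<h_{\mathrm{pol}}(C_{n+1}(f))<h_{\mathrm{pol}}(2^f).$$ -/

import Mathlib

open Set Filter Topology TopologicalSpace

/-! ### Separated sets, topological entropy and polynomial entropy -/

/-- A finite set `E` is `(T, n, ε)`-separated if any two different points `x, y ∈ E` satisfy
`max_{0 ≤ k ≤ n - 1} d(T^k x, T^k y) ≥ ε`. -/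
def IsDynSeparated {X : Type*} [MetricSpace X] (T : X → X) (n : ℕ) (ε : ℝ) (E : Finset X) : Prop :=
  ∀ x ∈ E, ∀ y ∈ E, x ≠ y → ∃ k < n, ε ≤ dist (T^[k] x) (T^[k] y)

/-- `sep(T, n, ε)`: the maximal cardinality of a `(T, n, ε)`-separated set
(it is finite on a compact space, for `T` continuous and `ε > 0`). -/
noncomputable def sepCard {X : Type*} [MetricSpace X] (T : X → X) (n : ℕ) (ε : ℝ) : ℕ∞ :=
  ⨆ (E : Finset X) (_ : IsDynSeparated T n ε E), (E.card : ℕ∞)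

/-- `limsup_{n → ∞} log sep(T, n, ε) / a n`, in the extended reals. -/
noncomputable def sepGrowth {X : Type*} [MetricSpace X] (T : X → X) (a : ℕ → ℝ) (ε : ℝ) : EReal :=
  limsup (fun n : ℕ => ENNReal.log (sepCard T n ε : ENNReal) / (a n : EReal)) atTop

/-- `lim_{ε → 0} limsup_{n → ∞} log sep(T, n, ε) / a n`. For `a ≥ 0` the inner expression increases
as `ε` decreases, so that the limit is a supremum; see `tendsto_sepGrowth`. -/
noncomputable def sepEntropy {X : Type*} [MetricSpace X] (T : X → X) (a : ℕ → ℝ) : EReal :=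
  ⨆ (ε : ℝ) (_ : 0 < ε), sepGrowth T a ε

/-- The topological entropy `h(T)`. -/
noncomputable def topEntropy {X : Type*} [MetricSpace X] (T : X → X) : EReal :=
  sepEntropy T (fun n => (n : ℝ))

/-- The polynomial entropy `h_pol(T)`. -/
noncomputable def polEntropy {X : Type*} [MetricSpace X] (T : X → X) : EReal :=
  sepEntropy T (fun n => Real.log n)

theorem sepCard_anti {X : Type*} [MetricSpace X] (T : X → X) (n : ℕ) {ε δ : ℝ} (h : ε ≤ δ) :
    sepCard T n δ ≤ sepCard T n ε :=
  biSup_mono fun _ hE x hx y hy hxy =>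
    let ⟨k, hk, hd⟩ := hE x hx y hy hxy
    ⟨k, hk, h.trans hd⟩

theorem sepGrowth_anti {X : Type*} [MetricSpace X] (T : X → X) {a : ℕ → ℝ} (ha : ∀ n, 0 ≤ a n) :
    Antitone (sepGrowth T a) := by
  intro ε δ h
  refine limsup_le_limsup (Eventually.of_forall fun n => ?_)
  refine EReal.div_le_div_right_of_nonneg (by exact_mod_cast ha n) (ENNReal.log_le_log ?_)
  exact_mod_cast sepCard_anti T n h

/-- `sepEntropy` is the limit as `ε → 0` of the growth rates. -/
theorem tendsto_sepGrowth {X : Type*} [MetricSpace X] (T : X → X) {a : ℕ → ℝ}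
    (ha : ∀ n, 0 ≤ a n) : Tendsto (sepGrowth T a) (𝓝[>] 0) (𝓝 (sepEntropy T a)) := by
  have h := (sepGrowth_anti T ha).antitoneOn (Ioi (0 : ℝ)) |>.tendsto_nhdsGT
    (OrderTop.bddAbove _)
  rwa [sSup_image] at h

/-- The topological entropy defined by separated sets is Mathlib's topological entropy. -/
theorem topEntropy_eq_coverEntropy {X : Type*} [MetricSpace X] (T : X → X) :
    topEntropy T = Dynamics.coverEntropy T univ := by
  rw [Dynamics.coverEntropy_eq_iSup_basis_netEntropyEntourage Metric.uniformity_basis_dist]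
  refine le_antisymm ?_ ?_
  · refine iSup₂_le fun ε hε => le_iSup₂_of_le (ε / 2) (half_pos hε) ?_
    refine limsup_le_limsup (Eventually.of_forall fun n => ?_)
    refine EReal.div_le_div_right_of_nonneg (EReal.coe_nonneg.2 n.cast_nonneg)
      (ENNReal.log_le_log ?_)
    refine ENat.toENNReal_mono (iSup₂_le fun E hE => ?_)
    refine Dynamics.IsDynNetIn.card_le_netMaxcard ⟨subset_univ _, ?_⟩
    intro x hx y hy hxy
    refine Set.disjoint_left.2 fun z hzx hzy => ?_
    obtain ⟨k, hk, hd⟩ := hE x hx y hy hxy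
    rw [Dynamics.mem_ball_dynEntourage] at hzx hzy
    have h1 : dist (T^[k] x) (T^[k] z) < ε / 2 := hzx k hk
    have h2 : dist (T^[k] y) (T^[k] z) < ε / 2 := hzy k hk
    have h3 := dist_triangle_right (T^[k] x) (T^[k] y) (T^[k] z)
    linarith
  · refine iSup₂_le fun ε hε => le_iSup₂_of_le ε hε ?_
    refine limsup_le_limsup (Eventually.of_forall fun n => ?_)
    refine EReal.div_le_div_right_of_nonneg (EReal.coe_nonneg.2 n.cast_nonneg)
      (ENNReal.log_le_log ?_)
    refine ENat.toENNReal_mono (iSup₂_le fun E hE => ?_)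
    refine le_iSup₂_of_le E (fun x hx y hy hxy => ?_) le_rfl
    by_contra! hcon
    have hmem : y ∈ UniformSpace.ball y
        (Dynamics.dynEntourage T {p : X × X | dist p.1 p.2 < ε} n) := by
      rw [Dynamics.mem_ball_dynEntourage]
      intro k _
      simpa [UniformSpace.ball] using hε
    have hmem' : y ∈ UniformSpace.ball x
        (Dynamics.dynEntourage T {p : X × X | dist p.1 p.2 < ε} n) := by
      rw [Dynamics.mem_ball_dynEntourage]
      exact fun k hk => hcon k hk
    exact Set.disjoint_left.1 (hE.2 hx hy hxy) hmem' hmem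

/-- `x` is a wandering point of `f`: it has a neighbourhood `U` with `f^n(U) ∩ U = ∅` for all
`n ≥ 1`. -/
def IsWanderingPt {X : Type*} [TopologicalSpace X] (f : X → X) (x : X) : Prop :=
  ∃ U ∈ 𝓝 x, ∀ n : ℕ, 1 ≤ n → Disjoint (f^[n] '' U) U

/-! ### Hyperspaces and induced maps

For a compact metric space `X`, the hyperspace `2^X` of nonempty closed subsets is
`NonemptyCompacts X`, which carries the Hausdorff metric. -/

/-- The induced map `2^f : 2^X → 2^X`, `A ↦ f(A)`. -/
def hyperMap {X : Type*} [MetricSpace X] (f : C(X, X)) : NonemptyCompacts X → NonemptyCompacts X :=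
  NonemptyCompacts.map f f.continuous

/-- The hyperspace `C(X)` of connected elements of `2^X`. -/
def subcontinua (X : Type*) [MetricSpace X] : Set (NonemptyCompacts X) :=
  {K | IsConnected (K : Set X)}

/-- The hyperspace `C_n(X)` of elements of `2^X` with at most `n` connected components. -/
def subcontinuaN (X : Type*) [MetricSpace X] (n : ℕ) : Set (NonemptyCompacts X) :=
  {K | ENat.card (ConnectedComponents (K : Set X)) ≤ n}

theorem mapsTo_subcontinua {X : Type*} [MetricSpace X] (f : C(X, X)) :
    MapsTo (hyperMap f) (subcontinua X) (subcontinua X) :=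
  fun _ hK => IsConnected.image hK f f.continuous.continuousOn

theorem mapsTo_subcontinuaN {X : Type*} [MetricSpace X] (f : C(X, X)) (n : ℕ) :
    MapsTo (hyperMap f) (subcontinuaN X n) (subcontinuaN X n) := by
  intro K hK
  have hg : Continuous (fun x : (K : Set X) =>
      (⟨f x, mem_image_of_mem f x.2⟩ : (hyperMap f K : Set X))) :=
    (f.continuous.comp continuous_subtype_val).subtype_mk _
  have hs : Function.Surjective hg.connectedComponentsMap := by
    intro c
    obtain ⟨⟨y, x, hx, rfl⟩, rfl⟩ := ConnectedComponents.surjective_coe c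
    exact ⟨ConnectedComponents.mk ⟨x, hx⟩, rfl⟩
  exact (ENat.card_le_card_of_injective (Function.injective_surjInv hs)).trans hK

/-- The induced map `C(f) : C(X) → C(X)`, the restriction of `2^f`. -/
def contMap {X : Type*} [MetricSpace X] (f : C(X, X)) : subcontinua X → subcontinua X :=
  (mapsTo_subcontinua f).restrict

/-- The induced map `C_n(f) : C_n(X) → C_n(X)`, the restriction of `2^f`. -/
def contMapN {X : Type*} [MetricSpace X] (f : C(X, X)) (n : ℕ) :
    subcontinuaN X n → subcontinuaN X n :=
  (mapsTo_subcontinuaN f n).restrict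

/-! ### Counting separated sets -/

/-! Both parts follow once the entropy of $C_n(f)$ is shown to be $nc$ for all $n\ge1$, with a fixed
$c>0$: the chain is then strict, with $2^f$ bounded below by $C_{n+2}(f)$. The examples are the tent
map, with $c=\log 2$, and $x\mapsto x^2$, with $c=2$. An element of $C_n([0,1])$ is a union of $n$
intervals, so `sepCard_contMapN_le` reduces the upper bounds to coding the orbit of one interval.

For a monotone map the images of an interval are determined by those of its two endpoints. The orbit
of a point up to time $m$ has $O(m)$ codes at a fixed scale (`exists_code_of_monotone`), so an
interval has $O(m^2)$. For squaring this is sharp: the backward orbit of $1/4$ cuts part of $[0,1]$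
into cells, cell $j$ being seen at scale $1/8$ at time $j$, and unions of $n$ runs of cells have
$2n$ free endpoints (`le_sepCard_contMapN_sqMap`).

For the tent map only one endpoint counts. While the images of an interval are short they follow the
left endpoint, which has about $2^m$ codes; once an image is long, it covers $[0,1]$ after bounded
time. Hence there are $2^m$ codes up to a factor linear in $m$
(`exists_sepCard_contMapN_tentMap_le`). Sets of $n$ points with independent itineraries give the
matching lower bound (`le_sepCard_contMapN_tentMap`). -/

theorem sepCard_le_card_of_code {X β : Type*} [MetricSpace X] [Fintype β] {T : X → X} {m : ℕ}
    {ε : ℝ} (code : X → β)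
    (h : ∀ x y, code x = code y → ∀ k < m, dist (T^[k] x) (T^[k] y) < ε) :
    sepCard T m ε ≤ (Fintype.card β : ℕ∞) := by
  refine iSup₂_le fun E hE => ?_
  have hinj : Set.InjOn code (E : Set X) := by
    intro x hx y hy hxy
    by_contra hne
    obtain ⟨k, hk, hd⟩ := hE x hx y hy hne
    exact absurd (h x y hxy k hk) (not_lt.2 hd)
  have := Finset.card_le_card_of_injOn (t := Finset.univ) code (fun _ _ => Finset.mem_univ _) hinj
  exact_mod_cast this

theorem card_le_sepCard {X α : Type*} [MetricSpace X] [Fintype α] {T : X → X} {m : ℕ}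
    {ε : ℝ} (hε : 0 < ε) (F : α → X)
    (h : ∀ a b, a ≠ b → ∃ k < m, ε ≤ dist (T^[k] (F a)) (T^[k] (F b))) :
    (Fintype.card α : ℕ∞) ≤ sepCard T m ε := by
  classical
  have hinj : Function.Injective F := by
    intro a b hab
    by_contra hne
    obtain ⟨k, -, hd⟩ := h a b hne
    rw [hab, dist_self] at hd
    linarith
  refine le_iSup₂_of_le (Finset.univ.image F) ?_ ?_
  · intro x hx y hy hxy
    obtain ⟨a, -, rfl⟩ := Finset.mem_image.1 hx
    obtain ⟨b, -, rfl⟩ := Finset.mem_image.1 hy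
    exact h a b fun hab => hxy (by rw [hab])
  · rw [Finset.card_image_of_injective _ hinj, Finset.card_univ]

theorem sepEntropy_le_of_isometric_semiconj {X Y : Type*} [MetricSpace X] [MetricSpace Y]
    {T : X → X} {S : Y → Y} {a : ℕ → ℝ} (ha : ∀ n, 0 ≤ a n) (ι : X → Y)
    (hι : Isometry ι) (h : Function.Semiconj ι T S) : sepEntropy T a ≤ sepEntropy S a := by
  classical
  refine iSup₂_mono fun ε _ => limsup_le_limsup (Eventually.of_forall fun n => ?_)
  refine EReal.div_le_div_right_of_nonneg (by exact_mod_cast ha n) (ENNReal.log_le_log ?_)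
  refine ENat.toENNReal_mono (iSup₂_le fun E hE => le_iSup₂_of_le (E.image ι) ?_ ?_)
  · intro x hx y hy hxy
    obtain ⟨u, hu, rfl⟩ := Finset.mem_image.1 hx
    obtain ⟨v, hv, rfl⟩ := Finset.mem_image.1 hy
    obtain ⟨k, hk, hd⟩ := hE u hu v hv fun huv => hxy (by rw [huv])
    refine ⟨k, hk, ?_⟩
    rwa [← (h.iterate_right k).eq, ← (h.iterate_right k).eq, hι.dist_eq]
  · rw [Finset.card_image_of_injective _ hι.injective]

theorem ennreal_log_natCast {N : ℕ} (hN : N ≠ 0) :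
    ENNReal.log (((N : ℕ∞) : ENNReal)) = (Real.log N : EReal) := by
  rw [ENat.toENNReal_coe, ENNReal.log_pos_real (by exact_mod_cast hN) (ENNReal.natCast_ne_top N),
    ENNReal.toReal_natCast]

/-- A limsup dominates the limit along any subsequence, so separated sets need only be constructed
at the times `φ L`. -/
theorem le_sepGrowth {X : Type*} [MetricSpace X] {T : X → X} {a : ℕ → ℝ} (ha : ∀ n, 0 ≤ a n)
    {ε : ℝ} {φ N : ℕ → ℕ} (hφ : Tendsto φ atTop atTop)
    (hN : ∀ᶠ L in atTop, N L ≠ 0 ∧ (N L : ℕ∞) ≤ sepCard T (φ L) ε) {c : ℝ}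
    (hc : Tendsto (fun L => Real.log (N L) / a (φ L)) atTop (𝓝 c)) :
    (c : EReal) ≤ sepGrowth T a ε := by
  have h1 : Tendsto (fun L => ((Real.log (N L) / a (φ L) : ℝ) : EReal)) atTop (𝓝 (c : EReal)) :=
    (continuous_coe_real_ereal.tendsto c).comp hc
  rw [← h1.limsup_eq]
  refine le_trans (limsup_le_limsup (v := (fun n : ℕ =>
    ENNReal.log (sepCard T n ε : ENNReal) / (a n : EReal)) ∘ φ) ?_) ?_
  · filter_upwards [hN] with L hL
    rw [EReal.coe_div, ← ennreal_log_natCast hL.1]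
    exact EReal.div_le_div_right_of_nonneg (by exact_mod_cast ha _)
      (ENNReal.log_le_log (ENat.toENNReal_mono hL.2))
  · rw [limsup_comp]
    exact limsup_le_limsup_of_le hφ

theorem sepGrowth_le {X : Type*} [MetricSpace X] {T : X → X} {a : ℕ → ℝ} (ha : ∀ n, 0 ≤ a n)
    {ε : ℝ} {N : ℕ → ℕ}
    (hN : ∀ᶠ m in atTop, N m ≠ 0 ∧ sepCard T m ε ≤ (N m : ℕ∞)) {c : ℝ}
    (hc : Tendsto (fun m => Real.log (N m) / a m) atTop (𝓝 c)) :
    sepGrowth T a ε ≤ (c : EReal) := by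
  have h1 : Tendsto (fun L => ((Real.log (N L) / a L : ℝ) : EReal)) atTop (𝓝 (c : EReal)) :=
    (continuous_coe_real_ereal.tendsto c).comp hc
  rw [← h1.limsup_eq]
  refine limsup_le_limsup ?_
  filter_upwards [hN] with L hL
  rw [EReal.coe_div, ← ennreal_log_natCast hL.1]
  exact EReal.div_le_div_right_of_nonneg (by exact_mod_cast ha _)
    (ENNReal.log_le_log (ENat.toENNReal_mono hL.2))

/-! ### Hyperspaces -/

theorem coe_iterate_hyperMap {X : Type*} [MetricSpace X] (f : C(X, X)) (k : ℕ)
    (K : NonemptyCompacts X) : (((hyperMap f)^[k] K : NonemptyCompacts X) : Set X)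
      = f^[k] '' (K : Set X) := by
  induction k with
  | zero => simp
  | succ k ih =>
    rw [Function.iterate_succ_apply', hyperMap, NonemptyCompacts.coe_map, ← hyperMap, ih,
      image_image]
    simp only [Function.iterate_succ_apply']

theorem coe_iterate_contMapN {X : Type*} [MetricSpace X] (f : C(X, X)) (n k : ℕ)
    (K : subcontinuaN X n) : ((contMapN f n)^[k] K : NonemptyCompacts X)
      = (hyperMap f)^[k] (K : NonemptyCompacts X) := by
  rw [contMapN, MapsTo.iterate_restrict]
  rfl

theorem le_dist_of_mem {X : Type*} [MetricSpace X] {K L : NonemptyCompacts X} {x : X} {r : ℝ}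
    (hx : x ∈ K) (h : ∀ y ∈ L, r ≤ dist x y) : r ≤ dist K L := by
  rw [Metric.NonemptyCompacts.dist_eq]
  refine ((Metric.le_infDist L.nonempty).2 fun y hy => h y hy).trans
    (Metric.infDist_le_hausdorffDist_of_mem hx ?_)
  exact Metric.hausdorffEDist_ne_top_of_nonempty_of_bounded K.nonempty L.nonempty
    K.isCompact.isBounded L.isCompact.isBounded

theorem subcontinua_subset_subcontinuaN_one (X : Type*) [MetricSpace X] :
    subcontinua X ⊆ subcontinuaN X 1 := by
  intro K hK
  have : PreconnectedSpace (K : Set X) := isPreconnected_iff_preconnectedSpace.1 hK.isPreconnected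
  simp [subcontinuaN]

theorem sepEntropy_contMap_le {X : Type*} [MetricSpace X] (f : C(X, X)) {a : ℕ → ℝ}
    (ha : ∀ n, 0 ≤ a n) : sepEntropy (contMap f) a ≤ sepEntropy (contMapN f 1) a :=
  sepEntropy_le_of_isometric_semiconj ha
    (Set.inclusion (subcontinua_subset_subcontinuaN_one X)) (fun _ _ => rfl) fun _ => rfl

theorem sepEntropy_contMapN_le {X : Type*} [MetricSpace X] (f : C(X, X)) (n : ℕ) {a : ℕ → ℝ}
    (ha : ∀ n, 0 ≤ a n) : sepEntropy (contMapN f n) a ≤ sepEntropy (hyperMap f) a :=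
  sepEntropy_le_of_isometric_semiconj ha Subtype.val isometry_subtype_coe fun _ => rfl

/-- If the entropy of `C_n(f)` is `n * c` for all `n ≥ 1`, where `c > 0`, then the entropies of
`C(f)`, `C_n(f)`, `C_{n+1}(f)` and `2^f` are strictly increasing for `n ≥ 2`. -/
theorem sepEntropy_strict_chain {X : Type*} [MetricSpace X] (f : C(X, X)) {a : ℕ → ℝ}
    (ha : ∀ n, 0 ≤ a n) {c : ℝ} (hc : 0 < c)
    (h : ∀ n : ℕ, 1 ≤ n → sepEntropy (contMapN f n) a = ((n * c : ℝ) : EReal)) (n : ℕ)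
    (hn : 2 ≤ n) :
    sepEntropy (contMap f) a < sepEntropy (contMapN f n) a ∧
      sepEntropy (contMapN f n) a < sepEntropy (contMapN f (n + 1)) a ∧
      sepEntropy (contMapN f (n + 1)) a < sepEntropy (hyperMap f) a := by
  have hlt : ∀ i j : ℕ, 1 ≤ i → i < j →
      sepEntropy (contMapN f i) a < sepEntropy (contMapN f j) a := by
    intro i j hi hij
    rw [h i hi, h j (by omega), EReal.coe_lt_coe_iff]
    have : (i : ℝ) < j := by exact_mod_cast hij
    nlinarith
  -- $C(f)$ is compared through $C_1(f)$, and $2^f$ through $C_{n+2}(f)$.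
  exact ⟨(sepEntropy_contMap_le f ha).trans_lt (hlt 1 n le_rfl (by omega)),
    hlt n (n + 1) (by omega) (by omega),
    (hlt (n + 1) (n + 2) (by omega) (by omega)).trans_le (sepEntropy_contMapN_le f _ ha)⟩

/-- A union of `n` nonempty preconnected sets has at most `n` components. -/
theorem mem_subcontinuaN_of_eq_iUnion {X : Type*} [MetricSpace X] {n : ℕ} {K : NonemptyCompacts X}
    {S : Fin n → Set X} (hS : ∀ i, IsConnected (S i)) (hK : (K : Set X) = ⋃ i, S i) :
    K ∈ subcontinuaN X n := by
  have hsub : ∀ i, S i ⊆ K := fun i => hK ▸ subset_iUnion S i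
  choose p hp using fun i => (hS i).nonempty
  let φ : Fin n → ConnectedComponents (K : Set X) := fun i =>
    ConnectedComponents.mk ⟨p i, hsub i (hp i)⟩
  have hφ : Function.Surjective φ := by
    intro c
    obtain ⟨⟨x, hx⟩, rfl⟩ := ConnectedComponents.surjective_coe c
    have hx' := hx
    rw [hK] at hx'
    obtain ⟨i, hi⟩ := mem_iUnion.1 hx'
    refine ⟨i, ConnectedComponents.coe_eq_coe'.2 ?_⟩
    have hpre : IsPreconnected (Subtype.val ⁻¹' (S i) : Set (K : Set X)) := by
      refine (Topology.IsInducing.subtypeVal.isPreconnected_image).1 ?_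
      rw [Subtype.image_preimage_coe, inter_eq_right.2 (hsub i)]
      exact (hS i).isPreconnected
    exact hpre.subset_connectedComponent (x := ⟨x, hx⟩) hi
      (show (⟨p i, hsub i (hp i)⟩ : (K : Set X)) ∈ Subtype.val ⁻¹' S i from hp i)
  have := ENat.card_le_card_of_injective (Function.injective_surjInv hφ)
  simpa [subcontinuaN] using this

/-- An element of `C_n([0,1])` is a union of `n` closed intervals. -/
theorem exists_eq_iUnion_Icc {n : ℕ} {K : NonemptyCompacts unitInterval}
    (hK : K ∈ subcontinuaN unitInterval n) :
    ∃ a b : Fin n → unitInterval, (∀ i, a i ≤ b i) ∧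
      (K : Set unitInterval) = ⋃ i, Icc (a i) (b i) := by
  classical
  have hcard : ENat.card (ConnectedComponents (K : Set unitInterval)) ≤ n := hK
  have hfin : Finite (ConnectedComponents (K : Set unitInterval)) := by
    rw [← ENat.card_lt_top]
    exact hcard.trans_lt (ENat.natCast_lt_top n)
  have := Fintype.ofFinite (ConnectedComponents (K : Set unitInterval))
  obtain ⟨x₀, hx₀⟩ := K.nonempty
  have hne : Nonempty (ConnectedComponents (K : Set unitInterval)) :=
    ⟨ConnectedComponents.mk ⟨x₀, hx₀⟩⟩
  obtain ⟨e⟩ : Nonempty (ConnectedComponents (K : Set unitInterval) ↪ Fin n) := by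
    rw [Function.Embedding.nonempty_iff_card_le, Fintype.card_fin]
    rw [ENat.card_eq_coe_fintype_card] at hcard
    exact_mod_cast hcard
  have hsurj := Function.invFun_surjective e.injective
  -- `φ` enumerates the components, with repetitions if there are fewer than $n$.
  set φ := Function.invFun e
  have hcs : CompactSpace (K : Set unitInterval) := isCompact_iff_compactSpace.1 K.isCompact
  choose x hx using fun i => ConnectedComponents.surjective_coe (φ i)
  have hconn : ∀ i, IsConnected (Subtype.val '' connectedComponent (x i)) := fun i =>
    isConnected_connectedComponent.image _ continuous_subtype_val.continuousOn
  have hcomp : ∀ i, IsCompact (Subtype.val '' connectedComponent (x i)) := fun i =>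
    isClosed_connectedComponent.isCompact.image continuous_subtype_val
  have hIcc := fun i => eq_Icc_of_connected_compact (hconn i) (hcomp i)
  refine ⟨fun i => sInf (Subtype.val '' connectedComponent (x i)),
    fun i => sSup (Subtype.val '' connectedComponent (x i)), fun i => ?_, ?_⟩
  · have := (hconn i).nonempty
    rw [hIcc i] at this
    exact nonempty_Icc.1 this
  · simp_rw [← hIcc]
    refine Subset.antisymm (fun y hy => ?_) (iUnion_subset fun i => ?_)
    · obtain ⟨i, hi⟩ := hsurj (ConnectedComponents.mk ⟨y, hy⟩)
      refine mem_iUnion.2 ⟨i, ⟨y, hy⟩, ?_, rfl⟩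
      exact ConnectedComponents.coe_eq_coe'.1 (hi.symm.trans (hx i).symm)
    · rintro _ ⟨z, -, rfl⟩
      exact z.2

/-- If intervals with equal codes stay `ε`-close up to time `m`, then `sep(C_n(f), m, ε)` is at most
the `n`-th power of the number of codes. -/
theorem sepCard_contMapN_le {f : C(unitInterval, unitInterval)} {β : Type*} [Fintype β] {m : ℕ}
    {ε δ : ℝ} (hδ : 0 ≤ δ) (hδε : δ < ε) (n : ℕ) (code : unitInterval → unitInterval → β)
    (h : ∀ a b a' b', a ≤ b → a' ≤ b' → code a b = code a' b' → ∀ k < m, ∀ x ∈ Icc a b,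
      ∃ y ∈ Icc a' b', dist (f^[k] x) (f^[k] y) ≤ δ) :
    sepCard (contMapN f n) m ε ≤ ((Fintype.card β ^ n : ℕ) : ℕ∞) := by
  choose A B hAB hK using fun K : subcontinuaN unitInterval n => exists_eq_iUnion_Icc K.2
  have key : ∀ K L : subcontinuaN unitInterval n,
      (∀ i, code (A K i) (B K i) = code (A L i) (B L i)) → ∀ k < m,
      ∀ x ∈ f^[k] '' ((K : NonemptyCompacts unitInterval) : Set unitInterval),
      ∃ y ∈ f^[k] '' ((L : NonemptyCompacts unitInterval) : Set unitInterval), dist x y ≤ δ := by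
    rintro K L hKL k hk _ ⟨x, hx, rfl⟩
    rw [hK] at hx
    obtain ⟨i, hi⟩ := mem_iUnion.1 hx
    obtain ⟨y, hy, hd⟩ := h _ _ _ _ (hAB K i) (hAB L i) (hKL i) k hk x hi
    refine ⟨_, ⟨y, ?_, rfl⟩, hd⟩
    rw [hK]
    exact mem_iUnion.2 ⟨i, hy⟩
  have := sepCard_le_card_of_code (T := contMapN f n) (m := m) (ε := ε)
    (fun K (i : Fin n) => code (A K i) (B K i)) (fun K L hKL k hk => by
      rw [Subtype.dist_eq, coe_iterate_contMapN, coe_iterate_contMapN,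
        Metric.NonemptyCompacts.dist_eq, coe_iterate_hyperMap, coe_iterate_hyperMap]
      refine (Metric.hausdorffDist_le_of_mem_dist hδ
        (key K L (fun i => congrFun hKL i) k hk) fun x hx => ?_).trans_lt hδε
      exact key L K (fun i => (congrFun hKL i).symm) k hk x hx)
  simpa using this

/-! ### Polynomial entropy of the squaring map -/

/-- The points of the interval fall into at most `m * (N + 1) + 1` classes, such that points of the
same class stay `1 / N`-close under the first `m` iterates of a monotone map. -/
theorem exists_code_of_monotone {f : unitInterval → unitInterval} (hf : Monotone f) (m : ℕ) {N : ℕ}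
    (hN : 0 < N) : ∃ c : unitInterval → Fin (m * (N + 1) + 1), ∀ x y, c x = c y → ∀ k < m,
      dist (f^[k] x) (f^[k] y) ≤ 1 / N := by
  classical
  have hN' : (0 : ℝ) < N := by exact_mod_cast hN
  -- `S x` records which grid levels $j/N$ the orbit reaches at each time. By monotonicity these
  -- sets form a chain, so the cardinality alone determines `S x`; this makes the number of classes
  -- linear in `m`.
  let S : unitInterval → Finset (ℕ × ℕ) := fun x =>
    (Finset.range m ×ˢ Finset.range (N + 1)).filter fun p => (p.2 : ℝ) ≤ N * (f^[p.1] x : ℝ)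
  have hcard : ∀ x, (S x).card < m * (N + 1) + 1 := fun x =>
    Nat.lt_succ_of_le ((Finset.card_filter_le _ _).trans (by simp))
  have hmono : Monotone S := by
    intro x y hxy p hp
    rw [Finset.mem_filter] at hp ⊢
    refine ⟨hp.1, hp.2.trans ?_⟩
    have : (f^[p.1] x : ℝ) ≤ f^[p.1] y := hf.iterate p.1 hxy
    gcongr
  have key : ∀ x y, (S x).card = (S y).card → x ≤ y → ∀ k < m,
      dist (f^[k] x) (f^[k] y) ≤ 1 / N := by
    intro x y hc hxy k hk
    have hS : S x = S y := Finset.eq_of_subset_of_card_le (hmono hxy) hc.ge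
    have hle : (f^[k] x : ℝ) ≤ f^[k] y := hf.iterate k hxy
    have h0 : (0 : ℝ) ≤ N * (f^[k] y : ℝ) := mul_nonneg hN'.le (f^[k] y).2.1
    have h1 := (f^[k] y).2.2
    -- The highest level below $f^k(y)$ is also reached by $f^k(x)$, so the gap is less than $1/N$.
    have hmem : (k, ⌊N * (f^[k] y : ℝ)⌋₊) ∈ S y := by
      refine Finset.mem_filter.2 ⟨Finset.mem_product.2 ⟨Finset.mem_range.2 hk,
        Finset.mem_range.2 (Nat.lt_succ_of_le ?_)⟩, Nat.floor_le h0⟩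
      exact Nat.floor_le_of_le (by nlinarith)
    rw [← hS, Finset.mem_filter] at hmem
    have h2 := hmem.2
    have h3 := Nat.lt_floor_add_one (N * (f^[k] y : ℝ))
    rw [dist_comm, Subtype.dist_eq, Real.dist_eq, abs_of_nonneg (by linarith), le_div_iff₀ hN']
    simp only at h2
    nlinarith
  refine ⟨fun x => ⟨(S x).card, hcard x⟩, fun x y hxy k hk => ?_⟩
  have hxy' : (S x).card = (S y).card := congrArg Fin.val hxy
  rcases le_total x y with h | h
  · exact key x y hxy' h k hk
  · rw [dist_comm]
    exact key y x hxy'.symm h k hk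

/-- An interval is coded by the codes of its two endpoints, hence the exponent $2n$. A point of
$[a,b]$ outside $[a',b']$ lies between corresponding endpoints, and its iterates stay between
theirs. -/
theorem sepCard_contMapN_le_of_monotone {f : C(unitInterval, unitInterval)} (hf : Monotone f)
    (n m : ℕ) {N : ℕ} (hN : 0 < N) {ε : ℝ} (hε : 1 / (N : ℝ) < ε) :
    sepCard (contMapN f n) m ε ≤ (((m * (N + 1) + 1) ^ (2 * n) : ℕ) : ℕ∞) := by
  obtain ⟨c, hc⟩ := exists_code_of_monotone hf m hN
  have h0 : (0 : ℝ) ≤ 1 / N := by positivity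
  have := sepCard_contMapN_le (f := f) (m := m) h0 hε n (fun a b => (c a, c b)) ?_
  · rwa [Fintype.card_prod, Fintype.card_fin, ← pow_two, ← pow_mul] at this
  intro a b a' b' hab hab' hcode k hk x hx
  obtain ⟨ha, hb⟩ := Prod.ext_iff.1 hcode
  have hm := hf.iterate k
  rcases lt_or_ge x a' with h | h
  · refine ⟨a', ⟨le_rfl, hab'⟩, le_trans ?_ (hc _ _ ha k hk)⟩
    have h1 : (f^[k] a : ℝ) ≤ f^[k] x := hm hx.1
    have h2 : (f^[k] x : ℝ) ≤ f^[k] a' := hm h.le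
    rw [Subtype.dist_eq, Subtype.dist_eq, Real.dist_eq, Real.dist_eq, abs_le]
    constructor
    · linarith [neg_abs_le ((f^[k] a : ℝ) - f^[k] a')]
    · linarith [abs_nonneg ((f^[k] a : ℝ) - f^[k] a')]
  rcases le_or_gt x b' with h' | h'
  · exact ⟨x, ⟨h, h'⟩, by rwa [dist_self]⟩
  · refine ⟨b', ⟨hab', le_rfl⟩, le_trans ?_ (hc _ _ hb k hk)⟩
    have h1 : (f^[k] x : ℝ) ≤ f^[k] b := hm hx.2
    have h2 : (f^[k] b' : ℝ) ≤ f^[k] x := hm h'.le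
    rw [Subtype.dist_eq, Subtype.dist_eq, Real.dist_eq, Real.dist_eq, abs_le]
    constructor
    · linarith [abs_nonneg ((f^[k] b : ℝ) - f^[k] b')]
    · linarith [le_abs_self ((f^[k] b : ℝ) - f^[k] b')]

theorem tendsto_log_natCast_atTop : Tendsto (fun m : ℕ => Real.log m) atTop atTop :=
  Real.tendsto_log_atTop.comp tendsto_natCast_atTop_atTop

theorem tendsto_const_div_log (C : ℝ) : Tendsto (fun m : ℕ => C / Real.log m) atTop (𝓝 0) :=
  tendsto_const_nhds.div_atTop tendsto_log_natCast_atTop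

theorem polEntropy_contMapN_le_of_monotone {f : C(unitInterval, unitInterval)} (hf : Monotone f)
    (n : ℕ) : polEntropy (contMapN f n) ≤ ((2 * n : ℝ) : EReal) := by
  refine iSup₂_le fun ε hε => ?_
  obtain ⟨N, hN⟩ := exists_nat_one_div_lt hε
  refine sepGrowth_le (fun n => Real.log_natCast_nonneg n)
    (N := fun m => (m * (N + 3)) ^ (2 * n)) ?_ ?_
  · filter_upwards [eventually_ge_atTop 1] with m hm
    refine ⟨by positivity, (sepCard_contMapN_le_of_monotone hf n m N.succ_pos
      (by exact_mod_cast hN)).trans ?_⟩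
    have : m * (N + 1 + 1) + 1 ≤ m * (N + 3) := by nlinarith
    exact_mod_cast Nat.pow_le_pow_left this _
  · have h1 : Tendsto (fun m : ℕ => (2 * n : ℝ) * (1 + Real.log (N + 3 : ℝ) / Real.log m)) atTop
        (𝓝 ((2 * n : ℝ) * (1 + 0))) :=
      ((tendsto_const_div_log _).const_add 1).const_mul _
    rw [add_zero, mul_one] at h1
    refine h1.congr' ?_
    filter_upwards [eventually_ge_atTop 2] with m hm
    have hm' : (1 : ℝ) < m := by exact_mod_cast hm
    have hl : Real.log m ≠ 0 := (Real.log_pos hm').ne'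
    push_cast
    rw [Real.log_pow, Real.log_mul (by positivity) (by positivity)]
    field_simp
    push_cast
    ring

/-- The order automorphism `x ↦ x ^ 2` of the unit interval. -/
noncomputable def sqIso : unitInterval ≃o unitInterval :=
  StrictMono.orderIsoOfSurjective (fun x => x * x)
    (fun x y h => by
      have hx := x.2.1
      have h' : (x : ℝ) < y := h
      change (x : ℝ) * x < y * y
      nlinarith)
    (fun y => ⟨⟨√y, Real.sqrt_nonneg _, Real.sqrt_le_one.2 y.2.2⟩,
      Subtype.ext (Real.mul_self_sqrt y.2.1)⟩)

theorem coe_sqIso (x : unitInterval) : (sqIso x : ℝ) = x * x := rfl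

/-- The squaring map of the unit interval. -/
noncomputable def sqMap : C(unitInterval, unitInterval) := ⟨sqIso, sqIso.continuous⟩

theorem monotone_sqMap : Monotone sqMap := sqIso.monotone

theorem isHomeomorph_sqMap : IsHomeomorph sqMap := sqIso.toHomeomorph.isHomeomorph

theorem iterate_sqMap_le (k : ℕ) (x : unitInterval) : sqMap^[k] x ≤ x := by
  induction k with
  | zero => exact le_rfl
  | succ k ih =>
    rw [Function.iterate_succ_apply']
    refine le_trans ?_ ih
    change ((sqMap^[k] x : unitInterval) : ℝ) * _ ≤ _
    nlinarith [(sqMap^[k] x).2.1, (sqMap^[k] x).2.2]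

theorem exists_isWanderingPt_sqMap : ∃ x, IsWanderingPt sqMap x := by
  -- Iterates of a point below $0.6$ are at most $0.36<0.4$ from time 1 on.
  refine ⟨⟨1 / 2, by norm_num, by norm_num⟩, Subtype.val ⁻¹' Ioo (0.4 : ℝ) 0.6,
    continuous_subtype_val.continuousAt.preimage_mem_nhds (Ioo_mem_nhds (by norm_num)
      (by norm_num)), fun n hn => ?_⟩
  rw [Set.disjoint_left]
  rintro _ ⟨x, hx, rfl⟩ hx'
  obtain ⟨k, rfl⟩ := Nat.exists_eq_add_of_le' hn
  have h1 : ((sqMap^[k + 1] x : unitInterval) : ℝ) ≤ x * x := by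
    rw [Function.iterate_succ_apply]
    exact iterate_sqMap_le k (sqMap x)
  have h2 := hx.2
  have h3 := hx.1
  have h4 := hx'.1
  nlinarith

/-- The backward orbit of `1 / 4` under the squaring map. -/
noncomputable def sqRoot (j : ℕ) : unitInterval :=
  sqIso.symm^[j] ⟨1 / 4, by norm_num, by norm_num⟩

theorem strictMono_sqRoot : StrictMono sqRoot := by
  have h : ∀ j, sqRoot j < sqRoot (j + 1) := by
    intro j
    rw [sqRoot, sqRoot, Function.iterate_succ_apply]
    refine sqIso.symm.strictMono.iterate j (sqIso.lt_symm_apply.2 ?_)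
    change (1 / 4 : ℝ) * (1 / 4) < 1 / 4
    norm_num
  exact strictMono_nat_of_lt_succ h

theorem iterate_sqMap_symm (j : ℕ) (x : unitInterval) : sqMap^[j] (sqIso.symm^[j] x) = x :=
  Function.LeftInverse.iterate (fun y => sqIso.apply_symm_apply y) j x

theorem iterate_sqMap_sqRoot (j : ℕ) : (sqMap^[j] (sqRoot j) : ℝ) = 1 / 4 := by
  rw [sqRoot, iterate_sqMap_symm]

theorem iterate_sqMap_sqRoot_succ (j : ℕ) : (sqMap^[j] (sqRoot (j + 1)) : ℝ) = 1 / 2 := by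
  have h : sqIso.symm ⟨1 / 4, by norm_num, by norm_num⟩ = ⟨1 / 2, by norm_num, by norm_num⟩ := by
    rw [OrderIso.symm_apply_eq]
    refine Subtype.ext ?_
    rw [coe_sqIso]
    norm_num
  rw [sqRoot, Function.iterate_succ_apply, iterate_sqMap_symm, h]

/-- If `K` contains the cell `[sqRoot j, sqRoot (j + 1)]` and `L` does not meet its interior, then
the iterates of order `j` of `K` and `L` are far apart. -/
theorem le_dist_iterate_of_cell {K L : NonemptyCompacts unitInterval} (j : ℕ)
    (hK : Icc (sqRoot j) (sqRoot (j + 1)) ⊆ (K : Set unitInterval))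
    (hL : ∀ y ∈ L, y ≤ sqRoot j ∨ sqRoot (j + 1) ≤ y) :
    1 / 8 ≤ dist ((hyperMap sqMap)^[j] K) ((hyperMap sqMap)^[j] L) := by
  -- The iterate of order $j$ maps the cell onto $[1/4,1/2]$; $3/8$ is the midpoint, at distance
  -- $1/8$ from everything outside the interior.
  let c : unitInterval := ⟨3 / 8, by norm_num, by norm_num⟩
  have hm := monotone_sqMap.iterate j
  have hs : StrictMono (sqMap^[j]) := sqIso.strictMono.iterate j
  have hc : sqMap^[j] (sqIso.symm^[j] c) = c := iterate_sqMap_symm j c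
  refine le_dist_of_mem (x := c) ?_ fun y hy => ?_
  · rw [← SetLike.mem_coe, coe_iterate_hyperMap]
    refine ⟨sqIso.symm^[j] c, hK ⟨?_, ?_⟩, hc⟩
    · rw [← hs.le_iff_le, hc, ← Subtype.coe_le_coe, iterate_sqMap_sqRoot]
      change (1 / 4 : ℝ) ≤ 3 / 8
      norm_num
    · rw [← hs.le_iff_le, hc, ← Subtype.coe_le_coe, iterate_sqMap_sqRoot_succ]
      change (3 / 8 : ℝ) ≤ 1 / 2
      norm_num
  · rw [← SetLike.mem_coe, coe_iterate_hyperMap] at hy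
    obtain ⟨z, hz, rfl⟩ := hy
    rw [Subtype.dist_eq, Real.dist_eq]
    change (1 / 8 : ℝ) ≤ |3 / 8 - _|
    rcases hL z hz with h | h
    · have h1 : (sqMap^[j] z : ℝ) ≤ sqMap^[j] (sqRoot j) := hm h
      rw [iterate_sqMap_sqRoot] at h1
      exact le_trans (by linarith) (le_abs_self _)
    · have h1 : (sqMap^[j] (sqRoot (j + 1)) : ℝ) ≤ sqMap^[j] z := hm h
      rw [iterate_sqMap_sqRoot_succ] at h1
      exact le_trans (by linarith) (neg_le_abs _)

/-- The nonempty compact set `⋃ i, [a i, b i]`. -/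
def iUnionIcc {n : ℕ} (hn : 1 ≤ n) (a b : Fin n → unitInterval) (hab : ∀ i, a i ≤ b i) :
    NonemptyCompacts unitInterval where
  carrier := ⋃ i, Icc (a i) (b i)
  isCompact' := isCompact_iUnion fun _ => isCompact_Icc
  nonempty' := ⟨a ⟨0, hn⟩, mem_iUnion.2 ⟨_, le_rfl, hab _⟩⟩

theorem iUnionIcc_mem_subcontinuaN {n : ℕ} (hn : 1 ≤ n) (a b : Fin n → unitInterval)
    (hab : ∀ i, a i ≤ b i) : iUnionIcc hn a b hab ∈ subcontinuaN unitInterval n :=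
  mem_subcontinuaN_of_eq_iUnion (fun i => isConnected_Icc (hab i)) rfl

theorem sqRoot_cell_of_runs {n : ℕ} (hn : 1 ≤ n) {s t s' t' : Fin n → ℕ} (hst : ∀ i, s i ≤ t i)
    (hst' : ∀ i, s' i ≤ t' i) (j : ℕ) (hj : ∃ i, s i ≤ j ∧ j + 1 ≤ t i)
    (hj' : ∀ i, t' i ≤ j ∨ j + 1 ≤ s' i) :
    1 / 8 ≤ dist
      ((hyperMap sqMap)^[j] (iUnionIcc hn (fun i => sqRoot (s i)) (fun i => sqRoot (t i))
        fun i => strictMono_sqRoot.monotone (hst i)))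
      ((hyperMap sqMap)^[j] (iUnionIcc hn (fun i => sqRoot (s' i)) (fun i => sqRoot (t' i))
        fun i => strictMono_sqRoot.monotone (hst' i))) := by
  have hm := strictMono_sqRoot.monotone
  obtain ⟨i, h1, h2⟩ := hj
  refine le_dist_iterate_of_cell j ((Icc_subset_Icc (hm h1) (hm h2)).trans
    (subset_iUnion (fun i => Icc (sqRoot (s i)) (sqRoot (t i))) i)) fun y hy => ?_
  obtain ⟨i', h3, h4⟩ := mem_iUnion.1 hy
  exact (hj' i').imp (fun h => h4.trans (hm h)) fun h => (hm h).trans h3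

/-- The first $2nL$ cells are divided into $n$ windows of $2L$ cells. The $i$-th run starts in the
first half of window $i$ and ends in the second half, with $L$ choices each. If two such sets differ
at an endpoint, some cell of that window belongs to exactly one of them and tells them apart at the
time equal to its index. -/
theorem le_sepCard_contMapN_sqMap {n : ℕ} (hn : 1 ≤ n) (L : ℕ) :
    ((L ^ (2 * n) : ℕ) : ℕ∞) ≤ sepCard (contMapN sqMap n) (2 * n * L) (1 / 8) := by
  let s : (Fin n → Fin L × Fin L) → Fin n → ℕ := fun σ i => 2 * (i * L) + (σ i).1
  let t : (Fin n → Fin L × Fin L) → Fin n → ℕ := fun σ i => 2 * (i * L) + L + (σ i).2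
  have hst : ∀ σ i, s σ i ≤ t σ i := fun σ i => by
    have := (σ i).1.2
    simp only [s, t]
    omega
  have hlt : ∀ i i' : Fin n, i < i' → (i : ℕ) * L + L ≤ i' * L := fun i i' h => by
    have : (i : ℕ) + 1 ≤ i' := h
    nlinarith [Nat.mul_le_mul_right L this]
  let F : (Fin n → Fin L × Fin L) → subcontinuaN unitInterval n := fun σ =>
    ⟨_, iUnionIcc_mem_subcontinuaN hn (fun i => sqRoot (s σ i)) (fun i => sqRoot (t σ i))
      fun i => strictMono_sqRoot.monotone (hst σ i)⟩
  have hcell : ∀ σ τ j, (∃ i, s σ i ≤ j ∧ j + 1 ≤ t σ i) → (∀ i, t τ i ≤ j ∨ j + 1 ≤ s τ i) →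
      1 / 8 ≤ dist ((contMapN sqMap n)^[j] (F σ)) ((contMapN sqMap n)^[j] (F τ)) := by
    intro σ τ j h1 h2
    rw [Subtype.dist_eq, coe_iterate_contMapN, coe_iterate_contMapN]
    exact sqRoot_cell_of_runs hn (hst σ) (hst τ) j h1 h2
  have hsplit : ∀ (i : Fin n) (i' : Fin n), i' ≠ i →
      (i' : ℕ) * L + L ≤ i * L ∨ (i : ℕ) * L + L ≤ i' * L := fun i i' h =>
    (lt_or_gt_of_ne h).imp (hlt _ _) (hlt _ _)
  have hs : ∀ σ τ i, (σ i).1 < (τ i).1 → ∃ k < 2 * n * L,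
      1 / 8 ≤ dist ((contMapN sqMap n)^[k] (F σ)) ((contMapN sqMap n)^[k] (F τ)) := by
    intro σ τ i h
    have h' : ((σ i).1 : ℕ) < (τ i).1 := h
    have h1 := (τ i).1.2
    have h2 : (i : ℕ) * L + L ≤ n * L := by nlinarith [Nat.mul_le_mul_right L i.2]
    -- With the earlier start in `σ`, the cell `s σ i` lies in the run of `σ` and before that of
    -- `τ`; runs in other windows do not meet it.
    refine ⟨s σ i, by simp only [s]; nlinarith, hcell σ τ _ ⟨i, le_rfl, ?_⟩ fun i' => ?_⟩
    · simp only [s, t]; omega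
    · have h3 := (τ i').2.2
      by_cases hi : i' = i
      · subst hi; simp only [s, t]; omega
      · have := hsplit i i' hi
        simp only [s, t]; omega
  have ht : ∀ σ τ i, (σ i).2 < (τ i).2 → ∃ k < 2 * n * L,
      1 / 8 ≤ dist ((contMapN sqMap n)^[k] (F σ)) ((contMapN sqMap n)^[k] (F τ)) := by
    intro σ τ i h
    have h' : ((σ i).2 : ℕ) < (τ i).2 := h
    have h1 := (τ i).2.2
    have h2 : (i : ℕ) * L + L ≤ n * L := by nlinarith [Nat.mul_le_mul_right L i.2]
    have h3 := (τ i).1.2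
    -- With the earlier end in `σ`, the cell `t σ i` is the first one after the run of `σ` and still
    -- belongs to that of `τ`, so the roles are exchanged.
    refine ⟨t σ i, by simp only [t]; nlinarith, ?_⟩
    rw [dist_comm]
    refine hcell τ σ _ ⟨i, ?_, ?_⟩ fun i' => ?_
    · simp only [s, t]; omega
    · simp only [t]; omega
    · have h3 := (σ i').2.2
      by_cases hi : i' = i
      · subst hi; exact Or.inl le_rfl
      · have := hsplit i i' hi
        simp only [s, t]; omega
  have := card_le_sepCard (T := contMapN sqMap n) (m := 2 * n * L) (ε := 1 / 8) (by norm_num) F ?_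
  · rwa [Fintype.card_fun, Fintype.card_prod, Fintype.card_fin, Fintype.card_fin, ← pow_two,
      ← pow_mul] at this
  intro σ τ hne
  obtain ⟨i, hi⟩ := Function.ne_iff.1 hne
  by_cases h1 : (σ i).1 = (τ i).1
  · have h2 : (σ i).2 ≠ (τ i).2 := fun h2 => hi (Prod.ext h1 h2)
    rcases lt_or_gt_of_ne h2 with h | h
    · exact ht σ τ i h
    · obtain ⟨k, hk, hd⟩ := ht τ σ i h
      exact ⟨k, hk, by rwa [dist_comm]⟩
  · rcases lt_or_gt_of_ne h1 with h | h
    · exact hs σ τ i h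
    · obtain ⟨k, hk, hd⟩ := hs τ σ i h
      exact ⟨k, hk, by rwa [dist_comm]⟩

theorem polEntropy_contMapN_sqMap {n : ℕ} (hn : 1 ≤ n) :
    polEntropy (contMapN sqMap n) = ((2 * n : ℝ) : EReal) := by
  refine le_antisymm (polEntropy_contMapN_le_of_monotone monotone_sqMap n) ?_
  refine le_iSup₂_of_le (1 / 8 : ℝ) (by norm_num) ?_
  refine le_sepGrowth (fun n => Real.log_natCast_nonneg n) (φ := fun L => 2 * n * L)
    (N := fun L => L ^ (2 * n)) (tendsto_id.const_mul_atTop' (by omega)) ?_ ?_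
  · filter_upwards [eventually_ge_atTop 1] with L hL
    exact ⟨by positivity, le_sepCard_contMapN_sqMap hn L⟩
  · have h1 : Tendsto (fun L : ℕ => (2 * n : ℝ) / (Real.log (2 * n : ℝ) / Real.log L + 1)) atTop
        (𝓝 ((2 * n : ℝ) / (0 + 1))) :=
      tendsto_const_nhds.div ((tendsto_const_div_log _).add_const 1) (by norm_num)
    rw [zero_add, div_one] at h1
    refine h1.congr' ?_
    filter_upwards [eventually_ge_atTop 2] with L hL
    have hL' : (1 : ℝ) < L := by exact_mod_cast hL
    have hl : Real.log L ≠ 0 := (Real.log_pos hL').ne'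
    have hn' : (0 : ℝ) < n := by exact_mod_cast hn
    push_cast
    rw [Real.log_pow, Real.log_mul (x := 2 * (n : ℝ)) (by positivity) (by positivity)]
    field_simp
    push_cast
    ring

/-! ### Topological entropy of the tent map -/

/-- The full tent map. -/
noncomputable def tentMap : C(unitInterval, unitInterval) where
  toFun x := ⟨min (2 * (x : ℝ)) (2 - 2 * x),
    le_min (by linarith [x.2.1]) (by linarith [x.2.2]), by
      rcases le_total (x : ℝ) (1 / 2) with h | h
      · exact (min_le_left _ _).trans (by linarith)
      · exact (min_le_right _ _).trans (by linarith)⟩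
  continuous_toFun := by fun_prop

theorem coe_tentMap (x : unitInterval) : (tentMap x : ℝ) = min (2 * (x : ℝ)) (2 - 2 * x) := rfl

theorem dist_tentMap_le (x y : unitInterval) : dist (tentMap x) (tentMap y) ≤ 2 * dist x y := by
  rw [Subtype.dist_eq, Subtype.dist_eq, Real.dist_eq, Real.dist_eq, coe_tentMap, coe_tentMap]
  refine (abs_min_sub_min_le_max _ _ _ _).trans (max_le ?_ ?_)
  · rw [← mul_sub, abs_mul, abs_two]
  · rw [show (2 - 2 * (x : ℝ)) - (2 - 2 * y) = 2 * (y - x) by ring, abs_mul, abs_two, abs_sub_comm]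

theorem dist_iterate_tentMap_le (k : ℕ) (x y : unitInterval) :
    dist (tentMap^[k] x) (tentMap^[k] y) ≤ 2 ^ k * dist x y := by
  induction k with
  | zero => simp
  | succ k ih =>
    rw [Function.iterate_succ_apply', Function.iterate_succ_apply', pow_succ']
    exact (dist_tentMap_le _ _).trans (by linarith)

/-- The iterate of order `p` maps each dyadic interval of level `p` onto `[0,1]`. -/
theorem exists_iterate_tentMap_eq (p : ℕ) : ∀ j : ℕ, j < 2 ^ p → ∀ y : unitInterval,
    ∃ x : unitInterval, (j : ℝ) ≤ 2 ^ p * (x : ℝ) ∧ 2 ^ p * (x : ℝ) ≤ j + 1 ∧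
      tentMap^[p] x = y := by
  induction p with
  | zero =>
    intro j hj y
    obtain rfl : j = 0 := by simpa using hj
    exact ⟨y, by simpa using y.2.1, by simpa using y.2.2, rfl⟩
  | succ p ih =>
    intro j hj y
    rw [pow_succ] at hj
    rcases lt_or_ge j (2 ^ p) with h | h
    · obtain ⟨x, h1, h2, h3⟩ := ih j h y
      have hx : (x / 2 : ℝ) ∈ unitInterval := ⟨by linarith [x.2.1], by linarith [x.2.2]⟩
      refine ⟨⟨x / 2, hx⟩, ?_, ?_, ?_⟩
      · simp only [pow_succ]; linarith
      · simp only [pow_succ]; linarith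
      · rw [Function.iterate_succ_apply, ← h3]
        congr 1
        refine Subtype.ext ?_
        rw [coe_tentMap, min_eq_left (by simp only; linarith [x.2.2])]
        simp only
        ring
    · have hj' : ((2 ^ p * 2 - 1 - j : ℕ) : ℝ) = 2 ^ p * 2 - 1 - j := by
        rw [Nat.cast_sub (by omega), Nat.cast_sub (by omega)]
        push_cast
        ring
      obtain ⟨x, h1, h2, h3⟩ := ih (2 ^ p * 2 - 1 - j) (by omega) y
      rw [hj'] at h1 h2
      have hx : (1 - x / 2 : ℝ) ∈ unitInterval := ⟨by linarith [x.2.2], by linarith [x.2.1]⟩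
      refine ⟨⟨1 - x / 2, hx⟩, ?_, ?_, ?_⟩
      · simp only [pow_succ]; linarith
      · simp only [pow_succ]; linarith
      · rw [Function.iterate_succ_apply, ← h3]
        congr 1
        refine Subtype.ext ?_
        rw [coe_tentMap, min_eq_right (by simp only; linarith [x.2.2])]
        simp only
        ring

/-- Intervals of length at least `δ` are mapped onto `[0,1]` after a time depending only on `δ`. -/
theorem exists_iterate_tentMap_onto {δ : ℝ} (hδ : 0 < δ) : ∃ T : ℕ, ∀ u v : unitInterval,
    δ ≤ (v : ℝ) - u → ∀ y, ∃ x ∈ Icc u v, tentMap^[T] x = y := by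
  obtain ⟨T, hT⟩ := exists_pow_lt_of_lt_one (half_pos hδ) (by norm_num : (1 / 2 : ℝ) < 1)
  refine ⟨T, fun u v huv y => ?_⟩
  have h2 : (0 : ℝ) < 2 ^ T := by positivity
  -- An interval at least two level-`T` cells long contains a whole one, namely the first that
  -- starts at or after `u`.
  have hT' : 2 ≤ 2 ^ T * δ := by
    rw [one_div, inv_pow, inv_lt_iff_one_lt_mul₀ h2] at hT
    linarith
  have h0 : (0 : ℝ) ≤ 2 ^ T * (u : ℝ) := mul_nonneg h2.le u.2.1
  have h3 := Nat.le_ceil (2 ^ T * (u : ℝ))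
  have h4 := Nat.ceil_lt_add_one h0
  have h5 : 2 ^ T * δ ≤ 2 ^ T * ((v : ℝ) - u) := by gcongr
  have h6 : 2 ^ T * (v : ℝ) ≤ 2 ^ T * 1 := by gcongr; exact v.2.2
  have hlt : ⌈2 ^ T * (u : ℝ)⌉₊ < 2 ^ T := by
    have : (⌈2 ^ T * (u : ℝ)⌉₊ : ℝ) < 2 ^ T := by linarith
    exact_mod_cast this
  obtain ⟨x, hx1, hx2, hx3⟩ := exists_iterate_tentMap_eq T _ hlt y
  refine ⟨x, ⟨?_, ?_⟩, hx3⟩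
  · rw [← Subtype.coe_le_coe]
    exact le_of_mul_le_mul_left (h3.trans hx1) h2
  · rw [← Subtype.coe_le_coe]
    exact le_of_mul_le_mul_left (by linarith) h2

theorem dist_le_of_floor_eq {x y : unitInterval} {R : ℕ} (hR : 0 < R)
    (h : ⌊R * (x : ℝ)⌋₊ = ⌊R * (y : ℝ)⌋₊) : dist x y ≤ 1 / R := by
  have hR' : (0 : ℝ) < R := by exact_mod_cast hR
  have hx := mul_nonneg hR'.le x.2.1
  have hy := mul_nonneg hR'.le y.2.1
  have h1 := Nat.floor_le hx
  have h2 := Nat.lt_floor_add_one (R * (x : ℝ))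
  have h3 := Nat.floor_le hy
  have h4 := Nat.lt_floor_add_one (R * (y : ℝ))
  rw [h] at h1 h2
  rw [Subtype.dist_eq, Real.dist_eq, le_div_iff₀ hR', ← abs_of_pos hR', ← abs_mul, abs_le]
  constructor <;> nlinarith

/-- The index of the cell of length `1 / R` containing `x`. -/
noncomputable def gridIndex (R : ℕ) (x : unitInterval) : Fin (R + 1) :=
  ⟨⌊R * (x : ℝ)⌋₊, Nat.lt_succ_of_le (Nat.floor_le_of_le
    (mul_le_of_le_one_right R.cast_nonneg x.2.2))⟩

theorem dist_le_of_gridIndex_eq {x y : unitInterval} {R : ℕ} (hR : 0 < R)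
    (h : gridIndex R x = gridIndex R y) : dist x y ≤ 1 / R :=
  dist_le_of_floor_eq hR (congrArg Fin.val h)

/-- An interval is coded by the first time `τ` at which its image has length at least `δ` (or `m` if
there is none before), the position of its left endpoint at scale $2^{-m}/R$, and the set of grid
cells met by its image at time `τ`. Only the first two depend on `m`, giving the factor $(m+1)2^m$.
-/
theorem exists_sepCard_contMapN_tentMap_le {ε : ℝ} (hε : 0 < ε) : ∃ C : ℕ, 0 < C ∧ ∀ n m : ℕ,
    sepCard (contMapN tentMap n) m ε ≤ ((((m + 1) * 2 ^ m * C) ^ n : ℕ) : ℕ∞) := by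
  classical
  set δ := ε / 3 with hδ_def
  have hδ : 0 < δ := by positivity
  obtain ⟨T, hT⟩ := exists_iterate_tentMap_onto hδ
  -- A grid cell of length $1/R$ stays within `δ` while it is expanded for at most `T` steps.
  obtain ⟨R, hR⟩ := exists_nat_gt (2 ^ T / δ)
  have hR0 : (0 : ℝ) < R := lt_trans (by positivity) hR
  have hR0' : 0 < R := by exact_mod_cast hR0
  have hRδ : 2 ^ T * (1 / (R : ℝ)) ≤ δ := by
    rw [mul_one_div, div_le_iff₀ hR0]
    rw [div_lt_iff₀ hδ] at hR
    linarith
  refine ⟨(R + 1) * 2 ^ (R + 1), by positivity, fun n m => ?_⟩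
  let long : unitInterval → unitInterval → ℕ → Prop := fun a b k =>
    ∃ x ∈ Icc a b, ∃ y ∈ Icc a b, δ ≤ (tentMap^[k] y : ℝ) - tentMap^[k] x
  have hex : ∀ a b, ∃ k, k = m ∨ long a b k := fun _ _ => ⟨m, Or.inl rfl⟩
  let τ : unitInterval → unitInterval → ℕ := fun a b => Nat.find (hex a b)
  have hτ : ∀ a b, τ a b < m + 1 := fun a b => Nat.lt_succ_of_le (Nat.find_min' _ (Or.inl rfl))
  let code : unitInterval → unitInterval →
      (Fin (m + 1) × Fin (2 ^ m * R + 1)) × Finset (Fin (R + 1)) := fun a b =>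
    ((⟨τ a b, hτ a b⟩, gridIndex (2 ^ m * R) a),
      Finset.univ.filter fun j => ∃ x ∈ Icc a b, gridIndex R (tentMap^[τ a b] x) = j)
  refine (sepCard_contMapN_le (δ := 2 * δ) (by positivity) (by linarith) n code ?_).trans ?_
  · intro a b a' b' hab hab' hcode k hk x hx
    have hτ' : τ a b = τ a' b' := congrArg (fun c => (c.1.1 : ℕ)) hcode
    have ha : gridIndex (2 ^ m * R) a = gridIndex (2 ^ m * R) a' := congrArg (fun c => c.1.2) hcode
    have hset := congrArg Prod.snd hcode
    rcases lt_or_ge k (τ a b) with hkτ | hkτ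
    -- Before `τ` the image of $[a,b]$ is short, so $x$ is `δ`-close to $a$, which is `δ`-close to
    -- $a'$.
    · refine ⟨a', ⟨le_rfl, hab'⟩, ?_⟩
      have hshort : ¬ long a b k := fun h => Nat.find_min (hex a b) hkτ (Or.inr h)
      have h1 : dist (tentMap^[k] x) (tentMap^[k] a) ≤ δ := by
        rw [Subtype.dist_eq, Real.dist_eq]
        by_contra! hcon
        rcases lt_abs.1 hcon with h | h
        · exact hshort ⟨a, ⟨le_rfl, hab⟩, x, hx, h.le⟩
        · exact hshort ⟨x, hx, a, ⟨le_rfl, hab⟩, by linarith⟩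
      have h2 : dist (tentMap^[k] a) (tentMap^[k] a') ≤ δ := by
        have h3 := dist_le_of_gridIndex_eq (by positivity) ha
        have h4 : (2 : ℝ) ^ k ≤ 2 ^ m := pow_le_pow_right₀ one_le_two hk.le
        have h5 : (1 : ℝ) ≤ 2 ^ T := one_le_pow₀ one_le_two
        calc _ ≤ 2 ^ k * dist a a' := dist_iterate_tentMap_le _ _ _
          _ ≤ 2 ^ m * (1 / ((2 ^ m * R : ℕ) : ℝ)) := by gcongr
          _ = 1 * (1 / (R : ℝ)) := by push_cast; field_simp
          _ ≤ 2 ^ T * (1 / (R : ℝ)) := by gcongr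
          _ ≤ δ := hRδ
      linarith [dist_triangle (tentMap^[k] x) (tentMap^[k] a) (tentMap^[k] a')]
    obtain ⟨l, rfl⟩ := Nat.exists_eq_add_of_le' hkτ
    rcases le_or_gt l T with hl | hl
    -- For up to `T` steps after `τ`, a point of $[a',b']$ in the same grid cell at time `τ` serves.
    · have hmem : gridIndex R (tentMap^[τ a b] x) ∈ (code a b).2 :=
        Finset.mem_filter.2 ⟨Finset.mem_univ _, x, hx, rfl⟩
      rw [hset] at hmem
      obtain ⟨-, y, hy, hxy⟩ := Finset.mem_filter.1 hmem
      refine ⟨y, hy, ?_⟩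
      rw [← hτ'] at hxy
      rw [Function.iterate_add_apply, Function.iterate_add_apply]
      have h3 := dist_le_of_gridIndex_eq hR0' hxy
      have h4 : (2 : ℝ) ^ l ≤ 2 ^ T := pow_le_pow_right₀ one_le_two hl
      calc _ ≤ 2 ^ l * dist _ _ := dist_iterate_tentMap_le _ _ _
        _ ≤ 2 ^ T * (1 / (R : ℝ)) := by rw [dist_comm]; gcongr
        _ ≤ 2 * δ := by linarith
    -- More than `T` steps after `τ`, the image of $[a',b']$ is all of $[0,1]$, so some $y$ matches
    -- $x$ exactly.
    · have hlong : long a' b' (τ a' b') :=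
        (Nat.find_spec (hex a' b')).resolve_left (by change τ a' b' ≠ m; omega)
      obtain ⟨u, hu, v, hv, huv⟩ := hlong
      obtain ⟨i, rfl⟩ := Nat.exists_eq_add_of_le' hl.le
      obtain ⟨z, hz, hzx⟩ := hT _ _ huv (tentMap^[T] (tentMap^[τ a b] x))
      have hpre : IsPreconnected (tentMap^[τ a' b'] '' Icc a' b') :=
        isPreconnected_Icc.image _ (tentMap.continuous.iterate _).continuousOn
      obtain ⟨y, hy, rfl⟩ := hpre.Icc_subset (mem_image_of_mem _ hu) (mem_image_of_mem _ hv) hz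
      refine ⟨y, hy, ?_⟩
      rw [Function.iterate_add_apply, Function.iterate_add_apply, ← hzx, ← hτ',
        Function.iterate_add_apply tentMap (i + T), Function.iterate_add_apply tentMap i,
        dist_self]
      positivity
  · rw [Fintype.card_prod, Fintype.card_prod, Fintype.card_fin, Fintype.card_fin,
      Fintype.card_finset, Fintype.card_fin]
    have h : 2 ^ m * R + 1 ≤ 2 ^ m * (R + 1) := by
      have := Nat.one_le_two_pow (n := m)
      rw [mul_add]
      omega
    have h' : (m + 1) * (2 ^ m * R + 1) * 2 ^ (R + 1) ≤
        (m + 1) * 2 ^ m * ((R + 1) * 2 ^ (R + 1)) :=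
      calc _ ≤ (m + 1) * (2 ^ m * (R + 1)) * 2 ^ (R + 1) := by gcongr
        _ = _ := by ring
    exact_mod_cast Nat.pow_le_pow_left h' n

theorem topEntropy_contMapN_tentMap_le (n : ℕ) :
    topEntropy (contMapN tentMap n) ≤ ((n * Real.log 2 : ℝ) : EReal) := by
  refine iSup₂_le fun ε hε => ?_
  obtain ⟨C, hC0, hC⟩ := exists_sepCard_contMapN_tentMap_le hε
  refine sepGrowth_le (fun n => n.cast_nonneg)
    (N := fun m => (m * 2 ^ m * (2 * C)) ^ n) ?_ ?_
  · filter_upwards [eventually_ge_atTop 1] with m hm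
    refine ⟨by positivity, (hC n m).trans ?_⟩
    have : (m + 1) * 2 ^ m * C ≤ m * 2 ^ m * (2 * C) :=
      calc _ ≤ (2 * m) * 2 ^ m * C := by gcongr; omega
        _ = _ := by ring
    exact_mod_cast Nat.pow_le_pow_left this n
  · have h0 : Tendsto (fun m : ℕ => Real.log m / m) atTop (𝓝 0) :=
      Real.isLittleO_log_id_atTop.tendsto_div_nhds_zero.comp tendsto_natCast_atTop_atTop
    have h1 : Tendsto (fun m : ℕ => (n : ℝ) * (Real.log m / m + Real.log 2
        + Real.log (2 * C : ℝ) / m)) atTop (𝓝 ((n : ℝ) * (0 + Real.log 2 + 0))) :=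
      ((h0.add_const _).add (tendsto_const_div_atTop_nhds_zero_nat _)).const_mul _
    rw [add_zero, zero_add] at h1
    refine h1.congr' ?_
    filter_upwards [eventually_ge_atTop 1] with m hm
    have hm' : (0 : ℝ) < m := by exact_mod_cast hm
    have hC' : (0 : ℝ) < C := by exact_mod_cast hC0
    push_cast
    rw [Real.log_pow, Real.log_mul (x := m * 2 ^ m) (by positivity) (by positivity),
      Real.log_mul (x := (m : ℝ)) (by positivity) (by positivity), Real.log_pow]
    field_simp

/-- A point following the shifted word is pulled back into the cell of the first letter, which the
iterate of order `p` maps onto $[0,1]$. -/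
theorem exists_itinerary (p M : ℕ) : ∀ w : Fin M → ℕ, (∀ k, w k < 2 ^ p) →
    ∃ x : unitInterval, ∀ k : Fin M, (w k : ℝ) ≤ 2 ^ p * (tentMap^[p * k] x : ℝ) ∧
      2 ^ p * (tentMap^[p * k] x : ℝ) ≤ w k + 1 := by
  induction M with
  | zero => exact fun _ _ => ⟨0, fun k => k.elim0⟩
  | succ M ih =>
    intro w hw
    obtain ⟨y, hy⟩ := ih (fun k => w k.succ) fun k => hw _
    obtain ⟨x, h1, h2, h3⟩ := exists_iterate_tentMap_eq p (w 0) (hw 0) y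
    refine ⟨x, Fin.cases (by simpa using ⟨h1, h2⟩) fun k => ?_⟩
    rw [Fin.val_succ, mul_add, mul_one, Function.iterate_add_apply, h3]
    exact hy k

/-- Two distinct even-numbered cells have a full cell between them; adjacent cells could share a
point. -/
theorem le_dist_of_even_cells {p a b : ℕ} (hab : a ≠ b) {u v : unitInterval}
    (hu : ((2 * a : ℕ) : ℝ) ≤ 2 ^ p * (u : ℝ) ∧ 2 ^ p * (u : ℝ) ≤ (2 * a : ℕ) + 1)
    (hv : ((2 * b : ℕ) : ℝ) ≤ 2 ^ p * (v : ℝ) ∧ 2 ^ p * (v : ℝ) ≤ (2 * b : ℕ) + 1) :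
    1 / 2 ^ p ≤ dist u v := by
  have h2 : (0 : ℝ) < 2 ^ p := by positivity
  rw [Subtype.dist_eq, Real.dist_eq, div_le_iff₀' h2, ← abs_of_pos h2, ← abs_mul, le_abs]
  push_cast at hu hv
  rcases lt_or_gt_of_ne hab with h | h
  · have : (a : ℝ) + 1 ≤ b := by exact_mod_cast h
    right
    linarith
  · have : (b : ℝ) + 1 ≤ a := by exact_mod_cast h
    left
    linarith

/-- Families of `n` points, indexed by `n` words of length `M` over an alphabet with `K` letters,
that can be told apart before time `p * M`. -/
theorem exists_separated_tuples {n K p : ℕ} (h : 2 * (n * K) ≤ 2 ^ p) (hp : 0 < p) (M : ℕ) :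
    ∃ x : (Fin n → Fin M → Fin K) → Fin n → unitInterval, ∀ σ τ, σ ≠ τ → ∃ k < p * M, ∃ i,
      ∀ j, 1 / 2 ^ p ≤ dist (tentMap^[k] (x σ i)) (tentMap^[k] (x τ j)) := by
  -- The letters of the $i$-th word are tagged with $i$, so that the $n$ points use disjoint
  -- alphabets: where the words `σ i` and `τ i` differ, the $i$-th point of `σ` is far from every
  -- point of `τ`, as the Hausdorff metric requires. The factor 2 selects even cells.
  choose x hx using fun (σ : Fin n → Fin M → Fin K) (i : Fin n) =>
    exists_itinerary p M (fun k => 2 * (finProdFinEquiv (i, σ i k) : ℕ)) fun k => by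
      have := (finProdFinEquiv (i, σ i k)).2
      omega
  refine ⟨x, fun σ τ hne => ?_⟩
  obtain ⟨i, hi⟩ := Function.ne_iff.1 hne
  obtain ⟨k, hk⟩ := Function.ne_iff.1 hi
  refine ⟨p * k, Nat.mul_lt_mul_of_pos_left k.2 hp, i, fun j => ?_⟩
  refine le_dist_of_even_cells (fun heq => hk ?_) (hx σ i k) (hx τ j k)
  obtain ⟨rfl, h2⟩ := Prod.ext_iff.1 (finProdFinEquiv.injective (Fin.ext heq))
  exact h2

theorem le_sepCard_contMapN_tentMap {n K p : ℕ} (hn : 1 ≤ n) (h : 2 * (n * K) ≤ 2 ^ p)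
    (hp : 0 < p) (M : ℕ) :
    (((K ^ M) ^ n : ℕ) : ℕ∞) ≤ sepCard (contMapN tentMap n) (p * M) (1 / 2 ^ p) := by
  obtain ⟨x, hx⟩ := exists_separated_tuples h hp M
  let F : (Fin n → Fin M → Fin K) → subcontinuaN unitInterval n := fun σ =>
    ⟨_, iUnionIcc_mem_subcontinuaN hn (x σ) (x σ) fun _ => le_rfl⟩
  have := card_le_sepCard (T := contMapN tentMap n) (m := p * M) (ε := 1 / 2 ^ p)
    (by positivity) F ?_
  · simpa using this
  intro σ τ hne
  obtain ⟨k, hk, i, hi⟩ := hx σ τ hne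
  refine ⟨k, hk, ?_⟩
  rw [Subtype.dist_eq, coe_iterate_contMapN, coe_iterate_contMapN]
  refine le_dist_of_mem (x := tentMap^[k] (x σ i)) ?_ fun y hy => ?_
  · rw [← SetLike.mem_coe, coe_iterate_hyperMap]
    exact mem_image_of_mem _ (mem_iUnion.2 ⟨i, le_rfl, le_rfl⟩)
  · rw [← SetLike.mem_coe, coe_iterate_hyperMap] at hy
    obtain ⟨z, hz, rfl⟩ := hy
    obtain ⟨j, hj⟩ := mem_iUnion.1 hz
    obtain rfl : z = x τ j := le_antisymm hj.2 hj.1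
    exact hi j

theorem le_sepCard_tentMap {K p : ℕ} (h : 2 * K ≤ 2 ^ p) (hp : 0 < p) (M : ℕ) :
    (((K ^ M) ^ 1 : ℕ) : ℕ∞) ≤ sepCard tentMap (p * M) (1 / 2 ^ p) := by
  obtain ⟨x, hx⟩ := exists_separated_tuples (n := 1) (by simpa using h) hp M
  have := card_le_sepCard (T := tentMap) (m := p * M) (ε := 1 / 2 ^ p) (by positivity)
    (fun σ => x σ 0) fun σ τ hne => ?_
  · simpa using this
  obtain ⟨k, hk, i, hi⟩ := hx σ τ hne
  exact ⟨k, hk, by simpa [Subsingleton.elim i 0] using hi 0⟩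

theorem le_topEntropy_of_words {X : Type*} [MetricSpace X] {T : X → X} {n K p : ℕ} {ε : ℝ}
    (hε : 0 < ε) (hK : 0 < K) (hp : 0 < p)
    (h : ∀ M, (((K ^ M) ^ n : ℕ) : ℕ∞) ≤ sepCard T (p * M) ε) :
    ((n * Real.log K / p : ℝ) : EReal) ≤ topEntropy T := by
  refine le_iSup₂_of_le ε hε ?_
  refine le_sepGrowth (fun n => n.cast_nonneg) (φ := fun M => p * M)
    (N := fun M => (K ^ M) ^ n) (tendsto_id.const_mul_atTop' hp) ?_ ?_
  · exact Eventually.of_forall fun M => ⟨by positivity, h M⟩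
  · refine tendsto_const_nhds.congr' ?_
    filter_upwards [eventually_ge_atTop 1] with M hM
    have hM' : (0 : ℝ) < M := by exact_mod_cast hM
    have hp' : (0 : ℝ) < p := by exact_mod_cast hp
    push_cast
    rw [Real.log_pow, Real.log_pow]
    field_simp

theorem topEntropy_tentMap_pos : 0 < topEntropy tentMap := by
  -- Two letters in blocks of length 2 give the lower bound $(\log 2)/2$, enough for positivity.
  refine lt_of_lt_of_le ?_ (le_topEntropy_of_words (n := 1) (K := 2) (p := 2) (by positivity)
    two_pos two_pos (le_sepCard_tentMap (by norm_num) two_pos))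
  have := Real.log_pos one_lt_two
  exact_mod_cast (by positivity : (0 : ℝ) < (1 : ℕ) * Real.log (2 : ℕ) / (2 : ℕ))

/-- Even cells and disjoint alphabets cost a factor $2n\le2^{n+1}$ per block. Blocks of length
$n+q+1$ thus leave $2^q$ letters for each point, and the rate $nq\log 2/(n+q+1)$ tends to $n\log2$
as $q\to\infty$. -/
theorem topEntropy_contMapN_tentMap {n : ℕ} (hn : 1 ≤ n) :
    topEntropy (contMapN tentMap n) = ((n * Real.log 2 : ℝ) : EReal) := by
  refine le_antisymm (topEntropy_contMapN_tentMap_le n) ?_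
  have h1 : Tendsto (fun q : ℕ => (n : ℝ) * Real.log 2 / (1 + (n + 1 : ℝ) / q)) atTop
      (𝓝 ((n : ℝ) * Real.log 2 / (1 + 0))) :=
    tendsto_const_nhds.div ((tendsto_const_div_atTop_nhds_zero_nat _).const_add 1) (by norm_num)
  rw [add_zero, div_one] at h1
  refine le_of_tendsto ((continuous_coe_real_ereal.tendsto _).comp h1) ?_
  filter_upwards [eventually_ge_atTop 1] with q hq
  have hcount : 2 * (n * 2 ^ q) ≤ 2 ^ (n + q + 1) := by
    have := Nat.lt_two_pow_self (n := n)
    calc 2 * (n * 2 ^ q) ≤ 2 * (2 ^ n * 2 ^ q) := by gcongr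
      _ = _ := by ring
  refine le_trans (le_of_eq ?_) (le_topEntropy_of_words (n := n) (K := 2 ^ q) (p := n + q + 1)
    (by positivity) (by positivity) (by omega)
    (le_sepCard_contMapN_tentMap hn hcount (by omega)))
  have hq' : (0 : ℝ) < q := by exact_mod_cast hq
  simp only [Function.comp]
  congr 1
  push_cast
  rw [Real.log_pow]
  field_simp
  ring

theorem theorem1p5 :
    (∃ f : C(unitInterval, unitInterval), 0 < topEntropy f ∧
      ∀ n : ℕ, 2 ≤ n →
        topEntropy (contMap f) < topEntropy (contMapN f n) ∧
        topEntropy (contMapN f n) < topEntropy (contMapN f (n + 1)) ∧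
        topEntropy (contMapN f (n + 1)) < topEntropy (hyperMap f)) ∧
    (∃ f : C(unitInterval, unitInterval), IsHomeomorph f ∧ (∃ x, IsWanderingPt f x) ∧
      (∀ n : ℕ, 1 ≤ n → polEntropy (contMapN f n) = ((2 * n : ℕ) : EReal)) ∧
      ∀ n : ℕ, 2 ≤ n →
        polEntropy (contMap f) < polEntropy (contMapN f n) ∧
        polEntropy (contMapN f n) < polEntropy (contMapN f (n + 1)) ∧
        polEntropy (contMapN f (n + 1)) < polEntropy (hyperMap f)) := by
  refine ⟨⟨tentMap, topEntropy_tentMap_pos, fun n hn => ?_⟩, sqMap, isHomeomorph_sqMap,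
    exists_isWanderingPt_sqMap, fun n hn => ?_, fun n hn => ?_⟩
  · exact sepEntropy_strict_chain tentMap (fun n => n.cast_nonneg) (Real.log_pos one_lt_two)
      (fun n hn => topEntropy_contMapN_tentMap hn) n hn
  · rw [polEntropy_contMapN_sqMap hn]
    push_cast
    rfl
  · refine sepEntropy_strict_chain sqMap (fun n => Real.log_natCast_nonneg n) two_pos
      (fun n hn => ?_) n hn
    rw [mul_comm]
    exact polEntropy_contMapN_sqMap hn
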